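/- Let $M$ be a smooth manifold of dimension $4n+3$ ($n\ge 0$) with an almost $3$-contact metric structure $(\varphi_i,\xi_i,\eta_i,g)_{i=1,2,3}$: each $\varphi_i$ is a smooth $(1,1)$-tensor field, $\xi_i$ a smooth vector field and $\eta_i$ a smooth $1$-form with $$\varphi_i^2=-I+\eta_i\otimes\xi_i,\qquad \eta_i(\xi_i)=1;$$ for every even permutation $(i,j,k)$ of $(1,2,3)$, $$\varphi_k=\varphi_i\varphi_j-\eta_j\otimes\xi_i=-\varphi_j\varphi_i+\eta_i\otimes\xi_j,\quad \xi_k=\varphi_i\xi_j=-\varphi_j\xi_i,\quad \eta_k=\eta_i\circ\varphi_j=-\eta_j\circ\varphi_i;$$ and $g$ is a smooth Riemannian metric with $g(\varphi_iX,\varphi_iY)=g(X,Y)-\eta_i(X)\eta_i(Y)$ for $i=1,2,3$. Put $\Phi_i(X,Y)=g(X,\varphi_iY)$, and use the conventions $d\eta(X,Y)=X(\eta(Y))-Y(\eta(X))-\eta([X,Y])$ and $(\eta\wedge\theta)(X,Y)=\eta(X)\theta(Y)-\eta(Y)\theta(X)$. **Theorem (Generalized Kashiwada Theorem).** Suppose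 that $M$ is a $3$-$(\alpha,\delta)$-Sasaki manifold, that is, there are real constants $\alpha\neq 0$ and $\delta$ such that $$d\eta_i=2\alpha\,\Phi_i+2(\alpha-\delta)\,\eta_j\wedge\eta_k$$ for every even permutation $(i,j,k)$ of $(1,2,3)$. Then $M$ is hypernormal: for $i=1,2,3$ and all smooth vector fields $X,Y$ on $M$, $$N_{\varphi_i}(X,Y):=[\varphi_iX,\varphi_iY]+\varphi_i^2[X,Y]-\varphi_i[\varphi_iX,Y]-\varphi_i[X,\varphi_iY]+d\eta_i(X,Y)\,\xi_i=0.$$ -/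

import Mathlib

open Bundle VectorField
open scoped Manifold ContDiff

noncomputable section

/-! Throughout, `M` is a smooth manifold modelled on `ℝ^d`, and `𝓡 d` is the standard model. -/

/-- (Not necessarily continuous) vector fields on the `d`-dimensional manifold `M`. -/
abbrev VField (d : ℕ) (M : Type*) [TopologicalSpace M]
    [ChartedSpace (EuclideanSpace ℝ (Fin d)) M] :=
  (x : M) → TangentSpace (𝓡 d) x

/-- Smoothness of a vector field, as a section of the tangent bundle. -/
def VField.IsSmooth {d : ℕ} {M : Type*} [TopologicalSpace M]
    [ChartedSpace (EuclideanSpace ℝ (Fin d)) M] [IsManifold (𝓡 d) ∞ M] (X : VField d M) : Prop :=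
  ContMDiff (𝓡 d) ((𝓡 d).prod 𝓘(ℝ, EuclideanSpace ℝ (Fin d))) ∞
    (fun x ↦ TotalSpace.mk' (EuclideanSpace ℝ (Fin d)) x (X x))

/-- Fields of endomorphisms of the tangent bundle, that is `(1,1)`-tensor fields. -/
abbrev EndField (d : ℕ) (M : Type*) [TopologicalSpace M]
    [ChartedSpace (EuclideanSpace ℝ (Fin d)) M] :=
  (x : M) → TangentSpace (𝓡 d) x →L[ℝ] TangentSpace (𝓡 d) x

/-- Smoothness of a `(1,1)`-tensor field, as a section of the endomorphism bundle. -/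
def EndField.IsSmooth {d : ℕ} {M : Type*} [TopologicalSpace M]
    [ChartedSpace (EuclideanSpace ℝ (Fin d)) M] [IsManifold (𝓡 d) ∞ M] (φ : EndField d M) : Prop :=
  ContMDiff (𝓡 d)
    ((𝓡 d).prod 𝓘(ℝ, EuclideanSpace ℝ (Fin d) →L[ℝ] EuclideanSpace ℝ (Fin d))) ∞
    (fun x ↦ TotalSpace.mk' (EuclideanSpace ℝ (Fin d) →L[ℝ] EuclideanSpace ℝ (Fin d))
      (E := fun x : M ↦ (TangentSpace (𝓡 d) x →L[ℝ] TangentSpace (𝓡 d) x)) x (φ x))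

/-- Fields of covectors. -/
abbrev CovField (d : ℕ) (M : Type*) [TopologicalSpace M]
    [ChartedSpace (EuclideanSpace ℝ (Fin d)) M] :=
  (x : M) → TangentSpace (𝓡 d) x →L[ℝ] ℝ

/-- Smoothness of a field of covectors (so that it is a differential `1`-form), as a section of
the cotangent bundle. -/
def CovField.IsSmooth {d : ℕ} {M : Type*} [TopologicalSpace M]
    [ChartedSpace (EuclideanSpace ℝ (Fin d)) M] [IsManifold (𝓡 d) ∞ M] (η : CovField d M) : Prop :=
  ContMDiff (𝓡 d) ((𝓡 d).prod 𝓘(ℝ, EuclideanSpace ℝ (Fin d) →L[ℝ] ℝ)) ∞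
    (fun x ↦ TotalSpace.mk' (EuclideanSpace ℝ (Fin d) →L[ℝ] ℝ)
      (E := fun x : M ↦ (TangentSpace (𝓡 d) x →L[ℝ] ℝ)) x (η x))

/-- The exterior derivative of a `1`-form, evaluated on smooth vector fields:
`dη(X, Y) = X(η(Y)) - Y(η(X)) - η([X, Y])`. -/
def CovField.extD {d : ℕ} {M : Type*} [TopologicalSpace M]
    [ChartedSpace (EuclideanSpace ℝ (Fin d)) M] (η : CovField d M) (X Y : VField d M) (x : M) : ℝ :=
  mvfderiv (𝓡 d) (fun y ↦ η y (Y y)) x (X x) - mvfderiv (𝓡 d) (fun y ↦ η y (X y)) x (Y x)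
    - η x (mlieBracket (𝓡 d) X Y x)

/-- The wedge product of two `1`-forms, `(η ∧ θ)(X, Y) = η(X) θ(Y) - η(Y) θ(X)`. -/
def CovField.wedge {d : ℕ} {M : Type*} [TopologicalSpace M]
    [ChartedSpace (EuclideanSpace ℝ (Fin d)) M] (η θ : CovField d M) (X Y : VField d M) (x : M) :
    ℝ :=
  η x (X x) * θ x (Y x) - η x (Y x) * θ x (X x)

/-- The vector field `φ X`. -/
def EndField.app {d : ℕ} {M : Type*} [TopologicalSpace M]
    [ChartedSpace (EuclideanSpace ℝ (Fin d)) M] (φ : EndField d M) (X : VField d M) : VField d M :=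
  fun x ↦ φ x (X x)

/-- An almost contact structure `(φ, ξ, η)` on `M`. -/
structure AlmostContactStructure (d : ℕ) (M : Type*) [TopologicalSpace M]
    [ChartedSpace (EuclideanSpace ℝ (Fin d)) M] [IsManifold (𝓡 d) ∞ M] where
  φ : EndField d M
  ξ : VField d M
  η : CovField d M
  smooth_φ : φ.IsSmooth
  smooth_ξ : ξ.IsSmooth
  smooth_η : η.IsSmooth
  φ_sq : ∀ (x : M) (v : TangentSpace (𝓡 d) x), φ x (φ x v) = -v + η x v • ξ x
  η_ξ : ∀ x : M, η x (ξ x) = 1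

/-- The tensor `N_φ = [φ, φ] + dη ⊗ ξ` evaluated on vector fields `X`, `Y`, where `[φ, φ]` is the
Nijenhuis torsion of `φ`. -/
def AlmostContactStructure.nijenhuis {d : ℕ} {M : Type*} [TopologicalSpace M]
    [ChartedSpace (EuclideanSpace ℝ (Fin d)) M] [IsManifold (𝓡 d) ∞ M]
    (S : AlmostContactStructure d M) (X Y : VField d M) : VField d M :=
  fun x ↦
    mlieBracket (𝓡 d) (S.φ.app X) (S.φ.app Y) x
      + S.φ x (S.φ x (mlieBracket (𝓡 d) X Y x))
      - S.φ x (mlieBracket (𝓡 d) (S.φ.app X) Y x)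
      - S.φ x (mlieBracket (𝓡 d) X (S.φ.app Y) x)
      + S.η.extD X Y x • S.ξ x

/-- An almost contact structure is normal if its tensor `N_φ` vanishes. -/
def AlmostContactStructure.IsNormal {d : ℕ} {M : Type*} [TopologicalSpace M]
    [ChartedSpace (EuclideanSpace ℝ (Fin d)) M] [IsManifold (𝓡 d) ∞ M]
    (S : AlmostContactStructure d M) : Prop :=
  ∀ X Y : VField d M, X.IsSmooth → Y.IsSmooth → ∀ x : M, S.nijenhuis X Y x = 0

/-- An almost `3`-contact metric structure `(φ_i, ξ_i, η_i, g)` on `M`. The three structures are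
indexed by `Fin 3`, whose addition is cyclic, so that the even permutations `(i, j, k)` of the three
indices are exactly the triples `(i, i + 1, i + 2)`. -/
structure Almost3ContactMetricStructure (d : ℕ) (M : Type*) [TopologicalSpace M]
    [ChartedSpace (EuclideanSpace ℝ (Fin d)) M] [IsManifold (𝓡 d) ∞ M] where
  str : Fin 3 → AlmostContactStructure d M
  φ_eq : ∀ (i : Fin 3) (x : M) (v : TangentSpace (𝓡 d) x),
    (str (i + 2)).φ x v
      = (str i).φ x ((str (i + 1)).φ x v) - (str (i + 1)).η x v • (str i).ξ x
  φ_eq' : ∀ (i : Fin 3) (x : M) (v : TangentSpace (𝓡 d) x),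
    (str (i + 2)).φ x v
      = -(str (i + 1)).φ x ((str i).φ x v) + (str i).η x v • (str (i + 1)).ξ x
  ξ_eq : ∀ (i : Fin 3) (x : M), (str (i + 2)).ξ x = (str i).φ x ((str (i + 1)).ξ x)
  ξ_eq' : ∀ (i : Fin 3) (x : M), (str (i + 2)).ξ x = -(str (i + 1)).φ x ((str i).ξ x)
  η_eq : ∀ (i : Fin 3) (x : M) (v : TangentSpace (𝓡 d) x),
    (str (i + 2)).η x v = (str i).η x ((str (i + 1)).φ x v)
  η_eq' : ∀ (i : Fin 3) (x : M) (v : TangentSpace (𝓡 d) x),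
    (str (i + 2)).η x v = -(str (i + 1)).η x ((str i).φ x v)
  /-- The Riemannian metric. -/
  g : ContMDiffRiemannianMetric (𝓡 d) ∞ (EuclideanSpace ℝ (Fin d))
    (fun x : M ↦ TangentSpace (𝓡 d) x)
  compatible : ∀ (i : Fin 3) (x : M) (v w : TangentSpace (𝓡 d) x),
    g.inner x ((str i).φ x v) ((str i).φ x w)
      = g.inner x v w - (str i).η x v * (str i).η x w

/-- The fundamental `2`-form `Φ_i(X, Y) = g(X, φ_i Y)`. -/
def Almost3ContactMetricStructure.fundForm {d : ℕ} {M : Type*} [TopologicalSpace M]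
    [ChartedSpace (EuclideanSpace ℝ (Fin d)) M] [IsManifold (𝓡 d) ∞ M]
    (S : Almost3ContactMetricStructure d M) (i : Fin 3) (X Y : VField d M) (x : M) : ℝ :=
  S.g.inner x (X x) ((S.str i).φ x (Y x))

/-- The `3`-`(α, δ)`-Sasaki condition: `α ≠ 0` and `dη_i = 2 α Φ_i + 2 (α - δ) η_j ∧ η_k` for every
even permutation `(i, j, k)`. -/
def Almost3ContactMetricStructure.IsAlphaDeltaSasaki {d : ℕ} {M : Type*} [TopologicalSpace M]
    [ChartedSpace (EuclideanSpace ℝ (Fin d)) M] [IsManifold (𝓡 d) ∞ M]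
    (S : Almost3ContactMetricStructure d M) (α δ : ℝ) : Prop :=
  α ≠ 0 ∧ ∀ (i : Fin 3) (X Y : VField d M), X.IsSmooth → Y.IsSmooth → ∀ x : M,
    (S.str i).η.extD X Y x
      = 2 * α * S.fundForm i X Y x
        + 2 * (α - δ) * CovField.wedge (S.str (i + 1)).η (S.str (i + 2)).η X Y x

/-- An almost `3`-contact metric structure is hypernormal if each of its three almost contact
structures is normal. -/
def Almost3ContactMetricStructure.IsHypernormal {d : ℕ} {M : Type*} [TopologicalSpace M]
    [ChartedSpace (EuclideanSpace ℝ (Fin d)) M] [IsManifold (𝓡 d) ∞ M]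
    (S : Almost3ContactMetricStructure d M) : Prop :=
  ∀ i : Fin 3, (S.str i).IsNormal

end

/-! ### Closure properties of smooth fields and the Jacobi identity. -/

section SmoothFields

variable {d : ℕ} {M : Type*} [TopologicalSpace M]
  [ChartedSpace (EuclideanSpace ℝ (Fin d)) M] [IsManifold (𝓡 d) ∞ M]

/-! Fix an even permutation (i, j, k) and write ω_l = dη_l, θ = η_j + √-1 η_k and Ω = dθ = ω_j + √-1
ω_k. For A in ker η_i, the vector A + √-1 φ_i A lies in the kernels of η_i, θ and Ω. Conversely
these conditions characterise such vectors, because α ≠ 0 and g is definite (`eq_φ_of_sasakiForm`).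
Normality of φ_i thus becomes an involutivity statement, in the spirit of Hitchin's lemma for
hyperkähler structures.

Since dΩ = 0, the kernel of Ω is closed under brackets; the η_i-component of such a bracket vanishes
because ω_i is φ_i-invariant, and the θ-component because Ω = dθ. This gives `φ_mlieBracket`, which
is N = 0 on ker η_i. Moreover the contraction of Ω with ξ_i is -2√-1 δ θ, so L_{ξ_i} Ω = -2√-1 δ Ω
and the flow of ξ_i preserves the same kernel. This gives `mlieBracket_ξ_φ`. Splitting X = A +
η_i(X) ξ_i combines the two. Everything is written in real and imaginary parts, with ω_l given
pointwise by `sasakiForm`. -/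

theorem VField.IsSmooth.mdifferentiableAt {X : VField d M} (hX : X.IsSmooth) (x : M) :
    MDifferentiableAt (𝓡 d) ((𝓡 d).prod 𝓘(ℝ, EuclideanSpace ℝ (Fin d)))
      (fun x ↦ TotalSpace.mk' (EuclideanSpace ℝ (Fin d)) x (X x)) x :=
  ContMDiff.mdifferentiable hX (by simp) x

theorem VField.IsSmooth.add {X Y : VField d M} (hX : X.IsSmooth) (hY : Y.IsSmooth) :
    VField.IsSmooth (X + Y) :=
  ContMDiff.add_section hX hY

theorem VField.IsSmooth.neg {X : VField d M} (hX : X.IsSmooth) : VField.IsSmooth (-X) :=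
  ContMDiff.neg_section hX

theorem VField.IsSmooth.sub {X Y : VField d M} (hX : X.IsSmooth) (hY : Y.IsSmooth) :
    VField.IsSmooth (X - Y) :=
  ContMDiff.sub_section hX hY

theorem VField.IsSmooth.smul {f : M → ℝ} {X : VField d M} (hf : ContMDiff (𝓡 d) 𝓘(ℝ) ∞ f)
    (hX : X.IsSmooth) : VField.IsSmooth (f • X) :=
  ContMDiff.smul_section hf hX

theorem EndField.IsSmooth.app {φ : EndField d M} {X : VField d M} (hφ : φ.IsSmooth)
    (hX : X.IsSmooth) : VField.IsSmooth (φ.app X) :=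
  ContMDiff.clm_bundle_apply (F₁ := EuclideanSpace ℝ (Fin d)) (F₂ := EuclideanSpace ℝ (Fin d))
    hφ hX

theorem CovField.IsSmooth.apply {η : CovField d M} {X : VField d M} (hη : η.IsSmooth)
    (hX : X.IsSmooth) : ContMDiff (𝓡 d) 𝓘(ℝ) ∞ (fun x ↦ η x (X x)) := by
  have := ContMDiff.clm_bundle_apply (F₁ := EuclideanSpace ℝ (Fin d)) (F₂ := ℝ)
    (E₂ := Bundle.Trivial M ℝ) (b := id) (IB := 𝓡 d) (n := ∞) (ϕ := η) (v := X) hη hX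
  intro x
  have h := (Bundle.contMDiffAt_section x).1 (this x)
  exact h

theorem VField.IsSmooth.mlieBracket {X Y : VField d M} (hX : X.IsSmooth) (hY : Y.IsSmooth) :
    VField.IsSmooth (mlieBracket (𝓡 d) X Y) := by
  have : IsManifold (𝓡 d) (((⊤ : ℕ∞) : WithTop ℕ∞) + 1) M := by simpa
  have : IsManifold (𝓡 d) (minSmoothness ℝ 2) M :=
    .of_le (n := ∞) (by simpa using ENat.LEInfty.out)
  exact ContDiff.mlieBracket_vectorField (m := ⊤) (n := ⊤) hX hY (by simp)

theorem mlieBracket_jacobi {X Y Z : VField d M} (hX : X.IsSmooth) (hY : Y.IsSmooth)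
    (hZ : Z.IsSmooth) (x : M) :
    mlieBracket (𝓡 d) X (mlieBracket (𝓡 d) Y Z) x =
      mlieBracket (𝓡 d) (mlieBracket (𝓡 d) X Y) Z x
        + mlieBracket (𝓡 d) Y (mlieBracket (𝓡 d) X Z) x := by
  have h2 : minSmoothness ℝ 2 ≤ ∞ := by simpa using ENat.LEInfty.out
  have : IsManifold (𝓡 d) (minSmoothness ℝ 3) M :=
    .of_le (n := ∞) (by simpa using ENat.LEInfty.out)
  exact leibniz_identity_mlieBracket_apply ((hX x).of_le h2) ((hY x).of_le h2) ((hZ x).of_le h2)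

end SmoothFields

/-! ### Vector fields as derivations, and d² = 0 on 1-forms. -/

section Derivations

variable {d : ℕ} {M : Type*} [TopologicalSpace M]
  [ChartedSpace (EuclideanSpace ℝ (Fin d)) M]

/-- The derivative `X f` of a function along a vector field. -/
noncomputable def VField.deriv (X : VField d M) (f : M → ℝ) (x : M) : ℝ :=
  mvfderiv (𝓡 d) f x (X x)

theorem CovField.extD_eq (η : CovField d M) (X Y : VField d M) (x : M) :
    η.extD X Y x = X.deriv (fun y ↦ η y (Y y)) x - Y.deriv (fun y ↦ η y (X y)) x
      - η x (mlieBracket (𝓡 d) X Y x) := rfl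

theorem VField.deriv_const (X : VField d M) (c : ℝ) (x : M) : X.deriv (fun _ ↦ c) x = 0 := by
  have := mvfderiv_const (I := 𝓡 d) c (x := x)
  unfold VField.deriv
  erw [this]
  rfl

theorem VField.deriv_sub (X : VField d M) {f g : M → ℝ} (hf : ContMDiff (𝓡 d) 𝓘(ℝ) ∞ f)
    (hg : ContMDiff (𝓡 d) 𝓘(ℝ) ∞ g) (x : M) :
    X.deriv (fun y ↦ f y - g y) x = X.deriv f x - X.deriv g x := by
  have := mvfderiv_sub (I := 𝓡 d) (hf.mdifferentiable (by simp) x)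
    (hg.mdifferentiable (by simp) x)
  unfold VField.deriv
  erw [this]
  rfl

theorem VField.deriv_neg (X : VField d M) (f : M → ℝ) (x : M) :
    X.deriv (fun y ↦ -f y) x = -X.deriv f x := by
  have := mvfderiv_neg (I := 𝓡 d) (g := f) (x := x)
  unfold VField.deriv
  erw [this]
  rfl

theorem VField.deriv_const_mul (X : VField d M) {f : M → ℝ} (hf : ContMDiff (𝓡 d) 𝓘(ℝ) ∞ f)
    (c : ℝ) (x : M) : X.deriv (fun y ↦ c * f y) x = c * X.deriv f x := by
  have := mvfderiv_mul (I := 𝓡 d) (f := fun _ ↦ c) (mdifferentiableAt_const (x := x))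
    (hf.mdifferentiable (by simp) x)
  have h := VField.deriv_const X c x
  unfold VField.deriv at h ⊢
  erw [this]
  simp [h]

variable [IsManifold (𝓡 d) ∞ M]

theorem mlieBracket_smul_of_isSmooth {X Y : VField d M} {f : M → ℝ}
    (hf : ContMDiff (𝓡 d) 𝓘(ℝ) ∞ f) (hY : Y.IsSmooth) (x : M) :
    mlieBracket (𝓡 d) X (f • Y) x = X.deriv f x • Y x + f x • mlieBracket (𝓡 d) X Y x := by
  have : IsManifold (𝓡 d) (minSmoothness ℝ 2) M :=
    .of_le (n := ∞) (by simpa using ENat.LEInfty.out)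
  exact mlieBracket_smul_right (hf.mdifferentiable (by simp) x) (hY.mdifferentiableAt x)

theorem mlieBracket_add_of_isSmooth {X Y Z : VField d M}
    (hY : Y.IsSmooth) (hZ : Z.IsSmooth) (x : M) :
    mlieBracket (𝓡 d) X (Y + Z) x
      = mlieBracket (𝓡 d) X Y x + mlieBracket (𝓡 d) X Z x := by
  have : IsManifold (𝓡 d) (minSmoothness ℝ 2) M :=
    .of_le (n := ∞) (by simpa using ENat.LEInfty.out)
  exact mlieBracket_add_right (hY.mdifferentiableAt x) (hZ.mdifferentiableAt x)

/-- A field with η(ξ) = 1 turns derivatives into brackets: X f = η([X, f ξ]) - f η([X, ξ]), and the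
right side is visibly smooth. -/
theorem AlmostContactStructure.deriv_smooth (S : AlmostContactStructure d M) {X : VField d M} {f : M → ℝ}
    (hX : X.IsSmooth) (hf : ContMDiff (𝓡 d) 𝓘(ℝ) ∞ f) :
    ContMDiff (𝓡 d) 𝓘(ℝ) ∞ (X.deriv f) := by
  have h1 := S.smooth_η.apply (hX.mlieBracket (VField.IsSmooth.smul hf S.smooth_ξ))
  have h2 := hf.mul (S.smooth_η.apply (hX.mlieBracket S.smooth_ξ))
  refine (h1.sub h2).congr fun x ↦ ?_
  rw [mlieBracket_smul_of_isSmooth hf S.smooth_ξ]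
  simp [S.η_ξ]

/-- The same device: expand the Jacobi identity for X, Y, f ξ, subtract f times the one for X, Y, ξ,
and read off the coefficient of ξ with η. -/
theorem AlmostContactStructure.deriv_mlieBracket (S : AlmostContactStructure d M) {X Y : VField d M} {f : M → ℝ}
    (hX : X.IsSmooth) (hY : Y.IsSmooth) (hf : ContMDiff (𝓡 d) 𝓘(ℝ) ∞ f) (x : M) :
    VField.deriv (mlieBracket (𝓡 d) X Y) f x
      = X.deriv (Y.deriv f) x - Y.deriv (X.deriv f) x := by
  have key : ∀ X Y : VField d M, X.IsSmooth → Y.IsSmooth →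
      mlieBracket (𝓡 d) X (mlieBracket (𝓡 d) Y (f • S.ξ)) x
        = X.deriv (Y.deriv f) x • S.ξ x + Y.deriv f x • mlieBracket (𝓡 d) X S.ξ x
          + (X.deriv f x • mlieBracket (𝓡 d) Y S.ξ x
            + f x • mlieBracket (𝓡 d) X (mlieBracket (𝓡 d) Y S.ξ) x) := by
    intro X Y hX hY
    have e : mlieBracket (𝓡 d) Y (f • S.ξ) = Y.deriv f • S.ξ + f • mlieBracket (𝓡 d) Y S.ξ := by
      funext y
      exact mlieBracket_smul_of_isSmooth hf S.smooth_ξ y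
    have hYf := S.deriv_smooth hY hf
    rw [e, mlieBracket_add_of_isSmooth (VField.IsSmooth.smul hYf S.smooth_ξ)
      (VField.IsSmooth.smul hf (hY.mlieBracket S.smooth_ξ)),
      mlieBracket_smul_of_isSmooth hYf S.smooth_ξ,
      mlieBracket_smul_of_isSmooth hf (hY.mlieBracket S.smooth_ξ)]
  have J := mlieBracket_jacobi hX hY (VField.IsSmooth.smul hf S.smooth_ξ) x
  rw [key X Y hX hY, key Y X hY hX, mlieBracket_smul_of_isSmooth hf S.smooth_ξ,
    mlieBracket_jacobi hX hY S.smooth_ξ] at J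
  have := congrArg (S.η x) J
  simp only [map_add, map_smul, S.η_ξ, smul_eq_mul] at this
  linarith

/-- This is d(dθ) = 0. Second derivatives cancel by `deriv_mlieBracket`, and the double brackets by
Jacobi. -/
theorem AlmostContactStructure.extD_extD (S : AlmostContactStructure d M) {θ : CovField d M}
    (hθ : θ.IsSmooth)
    {X Y Z : VField d M} (hX : X.IsSmooth) (hY : Y.IsSmooth) (hZ : Z.IsSmooth) (x : M) :
    X.deriv (θ.extD Y Z) x + Y.deriv (θ.extD Z X) x + Z.deriv (θ.extD X Y) x
      - θ.extD (mlieBracket (𝓡 d) X Y) Z x - θ.extD (mlieBracket (𝓡 d) Y Z) X x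
      - θ.extD (mlieBracket (𝓡 d) Z X) Y x = 0 := by
  have key : ∀ X Y Z : VField d M, X.IsSmooth → Y.IsSmooth → Z.IsSmooth →
      X.deriv (θ.extD Y Z) x = X.deriv (Y.deriv (fun y ↦ θ y (Z y))) x
        - X.deriv (Z.deriv (fun y ↦ θ y (Y y))) x
        - X.deriv (fun y ↦ θ y (mlieBracket (𝓡 d) Y Z y)) x := by
    intro X Y Z hX hY hZ
    have h1 := S.deriv_smooth hY (hθ.apply hZ)
    have h2 := S.deriv_smooth hZ (hθ.apply hY)
    rw [← VField.deriv_sub X h1 h2, ← VField.deriv_sub X (h1.sub h2) (hθ.apply (hY.mlieBracket hZ))]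
    rfl
  have J := congrArg (θ x) (mlieBracket_jacobi hX hY hZ x)
  rw [mlieBracket_swap_apply (V := X) (W := mlieBracket (𝓡 d) Y Z),
    mlieBracket_swap_apply (V := Y) (W := mlieBracket (𝓡 d) X Z),
    mlieBracket_swap (V := X) (W := Z)] at J
  rw [key X Y Z hX hY hZ, key Y Z X hY hZ hX, key Z X Y hZ hX hY]
  simp only [CovField.extD_eq, S.deriv_mlieBracket hX hY (hθ.apply hZ),
    S.deriv_mlieBracket hY hZ (hθ.apply hX), S.deriv_mlieBracket hZ hX (hθ.apply hY)]
  have e : mlieBracket (𝓡 d) (-mlieBracket (𝓡 d) Z X) Y x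
      = -mlieBracket (𝓡 d) (mlieBracket (𝓡 d) Z X) Y x := by
    have : IsManifold (𝓡 d) (minSmoothness ℝ 2) M :=
      .of_le (n := ∞) (by simpa using ENat.LEInfty.out)
    rw [← neg_one_smul ℝ (mlieBracket (𝓡 d) Z X),
      mlieBracket_const_smul_left ((hZ.mlieBracket hX).mdifferentiableAt x), neg_one_smul]
  rw [e] at J
  simp only [map_add, map_neg] at J
  linarith

end Derivations

/-! ### Linear algebra of the structure at a point. -/

section PointwiseAlgebra

variable {d : ℕ} {M : Type*} [TopologicalSpace M]
  [ChartedSpace (EuclideanSpace ℝ (Fin d)) M] [IsManifold (𝓡 d) ∞ M]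

namespace AlmostContactStructure

variable (S : AlmostContactStructure d M) (x : M)

/-- As φ²ξ = 0, evaluating φ² on φξ gives φξ = c ξ with c = η(φξ); then 0 = φ²ξ = c² ξ forces c = 0.
-/
theorem φ_ξ : S.φ x (S.ξ x) = 0 := by
  have h0 : S.φ x (S.φ x (S.ξ x)) = 0 := by simp [S.φ_sq, S.η_ξ]
  have h1 := S.φ_sq x (S.φ x (S.ξ x))
  rw [h0, map_zero] at h1
  have h2 : S.φ x (S.ξ x) = S.η x (S.φ x (S.ξ x)) • S.ξ x := by
    rw [eq_comm, neg_add_eq_zero] at h1; exact h1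
  have h3 : (S.η x (S.φ x (S.ξ x)) * S.η x (S.φ x (S.ξ x))) • S.ξ x = 0 := by
    have h4 := h0
    rw [h2, map_smul, h2, smul_smul] at h4
    simpa [S.η_ξ] using h4
  have h5 := congrArg (S.η x) h3
  simp only [map_smul, S.η_ξ, smul_eq_mul, mul_one, map_zero, mul_self_eq_zero] at h5
  rw [h2, h5, zero_smul]

theorem η_φ (v : TangentSpace (𝓡 d) x) : S.η x (S.φ x v) = 0 := by
  have h1 := S.φ_sq x (S.φ x v)
  rw [S.φ_sq x v, map_add, map_neg, map_smul, S.φ_ξ, smul_zero] at h1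
  have h2 := congrArg (S.η x) (add_left_cancel h1)
  simpa [S.η_ξ] using h2.symm

end AlmostContactStructure

namespace Almost3ContactMetricStructure

variable (S : Almost3ContactMetricStructure d M) (i : Fin 3) (x : M)
  (v w : TangentSpace (𝓡 d) x)

theorem inner_ξ : S.g.inner x v ((S.str i).ξ x) = (S.str i).η x v := by
  have h := S.compatible i x v ((S.str i).ξ x)
  rw [(S.str i).φ_ξ, map_zero, (S.str i).η_ξ] at h
  linarith

theorem inner_φ_right : S.g.inner x v ((S.str i).φ x w) = -S.g.inner x ((S.str i).φ x v) w := by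
  have h := S.compatible i x v ((S.str i).φ x w)
  rw [(S.str i).φ_sq, (S.str i).η_φ, map_add, map_neg, map_smul, inner_ξ, (S.str i).η_φ] at h
  simp only [smul_zero, mul_zero] at h
  linarith

/-- The structure equation for the cyclic relabelling (k, i, j), with indices reduced mod 3. -/
theorem η_add_one : (S.str (i + 1)).η x v = (S.str (i + 2)).η x ((S.str i).φ x v) := by
  have h := S.η_eq (i + 2) x v
  have h1 : i + 2 + 2 = i + 1 := by fin_cases i <;> rfl
  have h2 : i + 2 + 1 = i := by fin_cases i <;> rfl
  rwa [h1, h2] at h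

theorem η_φ_add_two : (S.str i).η x ((S.str (i + 2)).φ x v) = -(S.str (i + 1)).η x v := by
  have h := S.η_eq' (i + 2) x v
  have h1 : i + 2 + 2 = i + 1 := by fin_cases i <;> rfl
  have h2 : i + 2 + 1 = i := by fin_cases i <;> rfl
  rw [h1, h2] at h
  rw [h, neg_neg]

theorem φ_φ_add_two : (S.str i).φ x ((S.str (i + 2)).φ x v)
    = -(S.str (i + 1)).φ x v + (S.str (i + 2)).η x v • (S.str i).ξ x := by
  have h := S.φ_eq' (i + 2) x v
  have h1 : i + 2 + 2 = i + 1 := by fin_cases i <;> rfl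
  have h2 : i + 2 + 1 = i := by fin_cases i <;> rfl
  rw [h1, h2] at h
  rw [h]
  abel

theorem η_add_one_ξ : (S.str (i + 1)).η x ((S.str i).ξ x) = 0 := by
  rw [η_add_one, (S.str i).φ_ξ, map_zero]

theorem η_add_two_ξ : (S.str (i + 2)).η x ((S.str i).ξ x) = 0 := by
  rw [S.η_eq', (S.str i).φ_ξ, map_zero, neg_zero]

/-- The value at a point of the `2`-form `2 α Φ_i + 2 (α - δ) η_j ∧ η_k`. -/
noncomputable def sasakiForm (α δ : ℝ) : ℝ :=
  2 * α * S.g.inner x v ((S.str i).φ x w)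
    + 2 * (α - δ) * ((S.str (i + 1)).η x v * (S.str (i + 2)).η x w
      - (S.str (i + 1)).η x w * (S.str (i + 2)).η x v)

variable (α δ : ℝ)

theorem sasakiForm_swap : S.sasakiForm i x v w α δ = -S.sasakiForm i x w v α δ := by
  unfold sasakiForm
  rw [inner_φ_right, S.g.symm]
  ring

theorem sasakiForm_add_one : S.sasakiForm (i + 1) x v w α δ
    = 2 * α * S.g.inner x v ((S.str (i + 1)).φ x w)
    + 2 * (α - δ) * ((S.str (i + 2)).η x v * (S.str i).η x w
      - (S.str (i + 2)).η x w * (S.str i).η x v) := by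
  have h1 : i + 1 + 1 = i + 2 := by fin_cases i <;> rfl
  have h2 : i + 1 + 2 = i := by fin_cases i <;> rfl
  rw [sasakiForm, h1, h2]

theorem sasakiForm_add_two : S.sasakiForm (i + 2) x v w α δ
    = 2 * α * S.g.inner x v ((S.str (i + 2)).φ x w)
    + 2 * (α - δ) * ((S.str i).η x v * (S.str (i + 1)).η x w
      - (S.str i).η x w * (S.str (i + 1)).η x v) := by
  have h1 : i + 2 + 1 = i := by fin_cases i <;> rfl
  have h2 : i + 2 + 2 = i + 1 := by fin_cases i <;> rfl
  rw [sasakiForm, h1, h2]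

/-- φ_i is isometric modulo η_i, and it acts on the pair (η_j, η_k) as a quarter turn, which has
determinant 1 and so preserves η_j ∧ η_k. -/
theorem sasakiForm_φ_φ : S.sasakiForm i x ((S.str i).φ x v) ((S.str i).φ x w) α δ
    = S.sasakiForm i x v w α δ := by
  unfold sasakiForm
  rw [S.compatible, (S.str i).η_φ, ← η_add_one, ← η_add_one,
    S.η_eq' i x v, S.η_eq' i x w]
  ring

variable {v} in
-- Real part of Ω(v + √-1 φ_i v, ·) = 0; it comes from skewness of φ_i and φ_i φ_k = -φ_j + η_k ⊗
-- ξ_i. The imaginary part is `sasakiForm_add_two_eq`.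
theorem sasakiForm_add_one_eq (hv : (S.str i).η x v = 0) :
    S.sasakiForm (i + 1) x v w α δ = S.sasakiForm (i + 2) x ((S.str i).φ x v) w α δ := by
  have h := inner_φ_right S i x v ((S.str (i + 2)).φ x w)
  rw [φ_φ_add_two, map_add, map_neg, map_smul, inner_ξ, hv, smul_zero, add_zero, neg_inj] at h
  rw [sasakiForm_add_one, sasakiForm_add_two, ← h, (S.str i).η_φ, hv, S.η_eq' i x v]
  ring

variable {v} in
theorem sasakiForm_add_two_eq (hv : (S.str i).η x v = 0) :
    S.sasakiForm (i + 2) x v w α δ = -S.sasakiForm (i + 1) x ((S.str i).φ x v) w α δ := by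
  rw [sasakiForm_add_one_eq S i x w α δ ((S.str i).η_φ x v), (S.str i).φ_sq, hv]
  simp only [sasakiForm, zero_smul, add_zero, map_neg, neg_apply]
  ring

theorem sasakiForm_ξ : S.sasakiForm i x ((S.str i).ξ x) w α δ = 0 := by
  rw [sasakiForm, inner_φ_right, (S.str i).φ_ξ, η_add_one_ξ, η_add_two_ξ]
  simp

/-- The fundamental form contributes 2α and the wedge term -2(α - δ). With `sasakiForm_add_two_ξ`
this says that Ω(ξ_i, ·) = -2√-1 δ θ. -/
theorem sasakiForm_add_one_ξ :
    S.sasakiForm (i + 1) x ((S.str i).ξ x) w α δ = 2 * δ * (S.str (i + 2)).η x w := by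
  rw [sasakiForm_add_one, S.g.symm, inner_ξ, η_add_two_ξ, (S.str i).η_ξ, ← S.η_eq]
  ring

theorem sasakiForm_add_two_ξ :
    S.sasakiForm (i + 2) x ((S.str i).ξ x) w α δ = -(2 * δ) * (S.str (i + 1)).η x w := by
  rw [sasakiForm_add_two, S.g.symm, inner_ξ, η_add_one_ξ, (S.str i).η_ξ, η_φ_add_two]
  ring

variable {α v} in
-- When all three η vanish on v, the pairing ω_k(v, φ_k v) equals -2α g(v, v).
theorem eq_zero_of_sasakiForm (hα : α ≠ 0) (h0 : (S.str i).η x v = 0)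
    (h1 : (S.str (i + 1)).η x v = 0) (h2 : (S.str (i + 2)).η x v = 0)
    (h : S.sasakiForm (i + 2) x v ((S.str (i + 2)).φ x v) α δ = 0) : v = 0 := by
  rw [sasakiForm_add_two, (S.str (i + 2)).φ_sq, h0, h1, h2, zero_smul, add_zero, map_neg,
    η_φ_add_two, h1] at h
  by_contra hv
  have := S.g.pos x v hv
  have h' : 2 * α * S.g.inner x v v = 0 := by linarith
  simp [hα, this.ne'] at h'

end Almost3ContactMetricStructure

end PointwiseAlgebra

/-! ### Involutivity of the kernel of Ω. -/

section Normality

variable {d : ℕ} {M : Type*} [TopologicalSpace M]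
  [ChartedSpace (EuclideanSpace ℝ (Fin d)) M] [IsManifold (𝓡 d) ∞ M]

namespace Almost3ContactMetricStructure

theorem sasakiForm_add_left (S : Almost3ContactMetricStructure d M) (i : Fin 3) (x : M)
    (u v w : TangentSpace (𝓡 d) x) (α δ : ℝ) :
    S.sasakiForm i x (u + v) w α δ = S.sasakiForm i x u w α δ + S.sasakiForm i x v w α δ := by
  simp only [sasakiForm, map_add, add_apply]
  ring

theorem sasakiForm_sub_left (S : Almost3ContactMetricStructure d M) (i : Fin 3) (x : M)
    (u v w : TangentSpace (𝓡 d) x) (α δ : ℝ) :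
    S.sasakiForm i x (u - v) w α δ = S.sasakiForm i x u w α δ - S.sasakiForm i x v w α δ := by
  simp only [sasakiForm, map_sub, sub_apply]
  ring

theorem sasakiForm_neg_left (S : Almost3ContactMetricStructure d M) (i : Fin 3) (x : M)
    (v w : TangentSpace (𝓡 d) x) (α δ : ℝ) :
    S.sasakiForm i x (-v) w α δ = -S.sasakiForm i x v w α δ := by
  simp only [sasakiForm, map_neg, neg_apply]
  ring

theorem sasakiForm_smul_left (S : Almost3ContactMetricStructure d M) (i : Fin 3) (x : M)
    (c : ℝ) (v w : TangentSpace (𝓡 d) x) (α δ : ℝ) :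
    S.sasakiForm i x (c • v) w α δ = c * S.sasakiForm i x v w α δ := by
  simp only [sasakiForm, map_smul, smul_apply, smul_eq_mul]
  ring

variable {S : Almost3ContactMetricStructure d M} {α δ : ℝ}

theorem IsAlphaDeltaSasaki.extD_eq (hS : S.IsAlphaDeltaSasaki α δ) (i : Fin 3) {X Y : VField d M}
    (hX : X.IsSmooth) (hY : Y.IsSmooth) (x : M) :
    (S.str i).η.extD X Y x = S.sasakiForm i x (X x) (Y x) α δ :=
  hS.2 i X Y hX hY x

theorem IsAlphaDeltaSasaki.η_mlieBracket (hS : S.IsAlphaDeltaSasaki α δ) (i : Fin 3)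
    {X Y : VField d M} (hX : X.IsSmooth) (hY : Y.IsSmooth) (x : M) :
    (S.str i).η x (mlieBracket (𝓡 d) X Y x)
      = X.deriv (fun y ↦ (S.str i).η y (Y y)) x - Y.deriv (fun y ↦ (S.str i).η y (X y)) x
        - S.sasakiForm i x (X x) (Y x) α δ := by
  rw [← hS.extD_eq i hX hY, CovField.extD_eq]
  ring

theorem IsAlphaDeltaSasaki.sasakiForm_closed (hS : S.IsAlphaDeltaSasaki α δ) (i : Fin 3)
    {X Y Z : VField d M} (hX : X.IsSmooth) (hY : Y.IsSmooth) (hZ : Z.IsSmooth) (x : M) :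
    X.deriv (fun y ↦ S.sasakiForm i y (Y y) (Z y) α δ) x
      + Y.deriv (fun y ↦ S.sasakiForm i y (Z y) (X y) α δ) x
      + Z.deriv (fun y ↦ S.sasakiForm i y (X y) (Y y) α δ) x
      - S.sasakiForm i x (mlieBracket (𝓡 d) X Y x) (Z x) α δ
      - S.sasakiForm i x (mlieBracket (𝓡 d) Y Z x) (X x) α δ
      - S.sasakiForm i x (mlieBracket (𝓡 d) Z X x) (Y x) α δ = 0 := by
  have h := (S.str i).extD_extD (S.str i).smooth_η hX hY hZ x
  rw [hS.extD_eq i (hX.mlieBracket hY) hZ, hS.extD_eq i (hY.mlieBracket hZ) hX,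
    hS.extD_eq i (hZ.mlieBracket hX) hY, funext (hS.extD_eq i hX hY),
    funext (hS.extD_eq i hY hZ), funext (hS.extD_eq i hZ hX)] at h
  exact h

/-- The characterisation of the `φ_i`-type of `-U + √-1 V` by the `1`-form `η_i`, the complex
`1`-form `η_j + √-1 η_k` and the complex `2`-form `dη_j + √-1 dη_k`. -/
theorem eq_φ_of_sasakiForm (hα : α ≠ 0) (i : Fin 3) {U V : VField d M} (hU : U.IsSmooth)
    (hV : V.IsSmooth) (x : M) (hU0 : (S.str i).η x (U x) = 0) (hV0 : (S.str i).η x (V x) = 0)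
    (h1 : (S.str (i + 2)).η x (V x) = -(S.str (i + 1)).η x (U x))
    (h2 : (S.str (i + 1)).η x (V x) = (S.str (i + 2)).η x (U x))
    (h : ∀ Z : VField d M, Z.IsSmooth →
      S.sasakiForm (i + 1) x (U x) (Z x) α δ + S.sasakiForm (i + 2) x (V x) (Z x) α δ = 0) :
    V x = -(S.str i).φ x (U x) := by
  have hT : (V + (S.str i).φ.app U).IsSmooth := hV.add ((S.str i).smooth_φ.app hU)
  rw [eq_neg_iff_add_eq_zero]
  refine eq_zero_of_sasakiForm S i x δ hα ?_ ?_ ?_ ?_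
  · rw [map_add, hV0, (S.str i).η_φ, add_zero]
  · rw [map_add, h2, S.η_eq', neg_add_cancel]
  · rw [map_add, h1, ← η_add_one, neg_add_cancel]
  -- With T = V + φ_i U, the hypothesis reads ω_k(T, Z) = 0; the test field Z = φ_k T makes it
  -- definite.
  · have := h _ ((S.str (i + 2)).smooth_φ.app hT)
    rw [sasakiForm_add_one_eq S i x _ α δ hU0, add_comm, ← sasakiForm_add_left] at this
    exact this

/-- ξ_i preserves the kernel of Ω, since L_{ξ_i} Ω is a multiple of Ω. -/
theorem IsAlphaDeltaSasaki.mlieBracket_ξ_φ (hS : S.IsAlphaDeltaSasaki α δ) (i : Fin 3)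
    {A : VField d M} (hA : A.IsSmooth) (hA0 : ∀ x, (S.str i).η x (A x) = 0) (x : M) :
    mlieBracket (𝓡 d) (S.str i).ξ ((S.str i).φ.app A) x
      = (S.str i).φ x (mlieBracket (𝓡 d) (S.str i).ξ A x) := by
  have hξ := (S.str i).smooth_ξ
  have hB := (S.str i).smooth_φ.app hA
  set B := (S.str i).φ.app A with hBdef
  have hB0 : ∀ x, (S.str i).η x (B x) = 0 := fun x ↦ (S.str i).η_φ x (A x)
  have hj : ∀ x, (S.str (i + 1)).η x (A x) = (S.str (i + 2)).η x (B x) :=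
    fun x ↦ S.η_add_one i x (A x)
  have hk : ∀ x, (S.str (i + 2)).η x (A x) = -(S.str (i + 1)).η x (B x) :=
    fun x ↦ S.η_eq' i x (A x)
  have hK1 : ∀ x (w : TangentSpace (𝓡 d) x), S.sasakiForm (i + 1) x (A x) w α δ
      = S.sasakiForm (i + 2) x (B x) w α δ := fun x w ↦ S.sasakiForm_add_one_eq i x w α δ (hA0 x)
  have hK2 : ∀ x (w : TangentSpace (𝓡 d) x), S.sasakiForm (i + 2) x (A x) w α δ
      = -S.sasakiForm (i + 1) x (B x) w α δ := fun x w ↦ S.sasakiForm_add_two_eq i x w α δ (hA0 x)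
  -- Here U = -[ξ, A] and V = [ξ, B], so that -U + √-1 V = [ξ, A + √-1 B].
  have key : mlieBracket (𝓡 d) (S.str i).ξ B x
      = -(S.str i).φ x ((-mlieBracket (𝓡 d) (S.str i).ξ A) x) := by
    refine eq_φ_of_sasakiForm (δ := δ) hS.1 i (hξ.mlieBracket hA).neg (hξ.mlieBracket hB) x
      ?_ ?_ ?_ ?_ fun Z hZ ↦ ?_
    · simp only [Pi.neg_apply, map_neg, hS.η_mlieBracket i hξ hA, hA0, (S.str i).η_ξ,
        VField.deriv_const, sasakiForm_ξ]
      simp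
    · simp only [hS.η_mlieBracket i hξ hB, hB0, (S.str i).η_ξ, VField.deriv_const, sasakiForm_ξ]
      simp
    · simp only [Pi.neg_apply, map_neg, hS.η_mlieBracket _ hξ hA, hS.η_mlieBracket _ hξ hB,
        η_add_one_ξ, η_add_two_ξ, VField.deriv_const, sasakiForm_add_one_ξ, sasakiForm_add_two_ξ,
        hj, hk]
      ring
    · simp only [Pi.neg_apply, map_neg, hS.η_mlieBracket _ hξ hA, hS.η_mlieBracket _ hξ hB,
        η_add_one_ξ, η_add_two_ξ, VField.deriv_const, sasakiForm_add_one_ξ, sasakiForm_add_two_ξ,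
        hj, hk, VField.deriv_neg]
      ring
    · have c1 := hS.sasakiForm_closed (i + 1) hξ hA hZ x
      have c2 := hS.sasakiForm_closed (i + 2) hξ hB hZ x
      have e1 := hS.η_mlieBracket (i + 2) hA hZ x
      have e2 := hS.η_mlieBracket (i + 1) hB hZ x
      have d1 := fun W : VField d M ↦ VField.deriv_const_mul W
        ((S.str (i + 2)).smooth_η.apply hZ) (2 * δ) x
      have d2 := fun W : VField d M ↦ VField.deriv_const_mul W
        ((S.str (i + 1)).smooth_η.apply hZ) (2 * δ) x
      simp only [S.sasakiForm_swap _ _ (Z _) _ α δ,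
        S.sasakiForm_swap _ _ (mlieBracket (𝓡 d) A Z x) _ α δ,
        S.sasakiForm_swap _ _ (mlieBracket (𝓡 d) B Z x) _ α δ,
        S.sasakiForm_swap _ _ (mlieBracket (𝓡 d) Z (S.str i).ξ x) _ α δ,
        hK1, hK2, hk, sasakiForm_add_one_ξ, sasakiForm_add_two_ξ, VField.deriv_neg, d1, d2,
        mul_neg, neg_mul] at c1 c2 e1 e2
      simp only [Pi.neg_apply, sasakiForm_neg_left]
      -- `c1 - c2` is the real part of dΩ(ξ, A + √-1 B, Z) = 0. Its terms containing Ω(ξ, ·) are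
      -- multiples of θ, and `e1`, `e2` trade their derivatives for Ω, which kills A + √-1 B.
      linear_combination c1 - c2 - 2 * δ * e1 - 2 * δ * e2
  rw [key, Pi.neg_apply, map_neg, neg_neg]

theorem IsAlphaDeltaSasaki.φ_mlieBracket (hS : S.IsAlphaDeltaSasaki α δ) (i : Fin 3)
    {A A' : VField d M} (hA : A.IsSmooth) (hA' : A'.IsSmooth)
    (hA0 : ∀ x, (S.str i).η x (A x) = 0) (hA0' : ∀ x, (S.str i).η x (A' x) = 0) (x : M) :
    (S.str i).φ x (mlieBracket (𝓡 d) A ((S.str i).φ.app A') x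
        + mlieBracket (𝓡 d) ((S.str i).φ.app A) A' x)
      = mlieBracket (𝓡 d) ((S.str i).φ.app A) ((S.str i).φ.app A') x
        - mlieBracket (𝓡 d) A A' x := by
  have hB := (S.str i).smooth_φ.app hA
  have hB' := (S.str i).smooth_φ.app hA'
  have hω := S.sasakiForm_φ_φ i x (A x) (A' x) α δ
  -- Invariance with φ_i A' in the second slot yields ω_i(φ_i A, A') = -ω_i(A, φ_i A').
  have hω' := S.sasakiForm_φ_φ i x (A x) ((S.str i).φ x (A' x)) α δ
  rw [(S.str i).φ_sq, hA0', zero_smul, add_zero, S.sasakiForm_swap, sasakiForm_neg_left,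
    S.sasakiForm_swap i x (A' x), neg_neg] at hω'
  have hAB : ∀ {A : VField d M}, (∀ x, (S.str i).η x (A x) = 0) →
      (∀ x, (S.str i).η x ((S.str i).φ.app A x) = 0) ∧
      (∀ x, (S.str (i + 1)).η x (A x) = (S.str (i + 2)).η x ((S.str i).φ.app A x)) ∧
      (∀ x, (S.str (i + 2)).η x (A x) = -(S.str (i + 1)).η x ((S.str i).φ.app A x)) ∧
      (∀ x (w : TangentSpace (𝓡 d) x), S.sasakiForm (i + 1) x (A x) w α δ
        = S.sasakiForm (i + 2) x ((S.str i).φ.app A x) w α δ) ∧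
      (∀ x (w : TangentSpace (𝓡 d) x), S.sasakiForm (i + 2) x (A x) w α δ
        = -S.sasakiForm (i + 1) x ((S.str i).φ.app A x) w α δ) := fun {A} hA0 ↦
    ⟨fun x ↦ (S.str i).η_φ x (A x), fun x ↦ S.η_add_one i x (A x), fun x ↦ S.η_eq' i x (A x),
      fun x w ↦ S.sasakiForm_add_one_eq i x w α δ (hA0 x),
      fun x w ↦ S.sasakiForm_add_two_eq i x w α δ (hA0 x)⟩
  obtain ⟨hB0, hj, hk, hK1, hK2⟩ := hAB hA0
  obtain ⟨hB0', hj', hk', hK1', hK2'⟩ := hAB hA0'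
  change S.sasakiForm i x ((S.str i).φ.app A x) ((S.str i).φ.app A' x) α δ = _ at hω
  rw [neg_eq_iff_eq_neg] at hω'
  change S.sasakiForm i x ((S.str i).φ.app A x) (A' x) α δ
    = -S.sasakiForm i x (A x) ((S.str i).φ.app A' x) α δ at hω'
  set B := (S.str i).φ.app A with hBdef
  set B' := (S.str i).φ.app A' with hBdef'
  have hη : (S.str i).η x
      ((mlieBracket (𝓡 d) B B' - mlieBracket (𝓡 d) A A') x) = 0 := by
    simp only [Pi.sub_apply, map_sub, hS.η_mlieBracket _ hB hB', hS.η_mlieBracket _ hA hA',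
      hA0, hA0', hB0, hB0', VField.deriv_const, hω]
    ring
  -- U = [B, B'] - [A, A'] and V = [A, B'] + [B, A'] are minus the real part and the imaginary part
  -- of [A + √-1 B, A' + √-1 B'].
  have key : (mlieBracket (𝓡 d) A B' + mlieBracket (𝓡 d) B A') x
      = -(S.str i).φ x ((mlieBracket (𝓡 d) B B' - mlieBracket (𝓡 d) A A') x) := by
    refine eq_φ_of_sasakiForm (δ := δ) hS.1 i ((hB.mlieBracket hB').sub (hA.mlieBracket hA'))
      ((hA.mlieBracket hB').add (hB.mlieBracket hA')) x hη ?_ ?_ ?_ fun Z hZ ↦ ?_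
    · simp only [Pi.add_apply, map_add, hS.η_mlieBracket _ hA hB', hS.η_mlieBracket _ hB hA',
        hA0, hA0', hB0, hB0', VField.deriv_const, hω']
      ring
    · simp only [Pi.sub_apply, Pi.add_apply, map_sub, map_add, hS.η_mlieBracket _ hA hB',
        hS.η_mlieBracket _ hB hA', hS.η_mlieBracket _ hA hA', hS.η_mlieBracket _ hB hB',
        hj, hj', hk, hk', hK1, hK2, VField.deriv_neg]
      ring
    · simp only [Pi.sub_apply, Pi.add_apply, map_sub, map_add, hS.η_mlieBracket _ hA hB',
        hS.η_mlieBracket _ hB hA', hS.η_mlieBracket _ hA hA', hS.η_mlieBracket _ hB hB',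
        hj, hj', hk, hk', hK1, hK2, VField.deriv_neg]
      ring
    · have c1 := hS.sasakiForm_closed (i + 1) hA hA' hZ x
      have c2 := hS.sasakiForm_closed (i + 1) hB hB' hZ x
      have c3 := hS.sasakiForm_closed (i + 2) hA hB' hZ x
      have c4 := hS.sasakiForm_closed (i + 2) hB hA' hZ x
      simp only [S.sasakiForm_swap _ _ (Z _) _ α δ,
        S.sasakiForm_swap _ _ (mlieBracket (𝓡 d) A' Z x) _ α δ,
        S.sasakiForm_swap _ _ (mlieBracket (𝓡 d) B' Z x) _ α δ,
        S.sasakiForm_swap _ _ (mlieBracket (𝓡 d) Z A x) _ α δ,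
        S.sasakiForm_swap _ _ (mlieBracket (𝓡 d) Z B x) _ α δ,
        hK1, hK2, hK1', hK2', VField.deriv_neg] at c1 c2 c3 c4
      simp only [Pi.sub_apply, Pi.add_apply, sasakiForm_sub_left, sasakiForm_add_left]
      -- The combination `c1 - c2 - c3 - c4` is the real part of dΩ(A + √-1 B, A' + √-1 B', Z) = 0,
      -- where only the term with the bracket of the first two arguments survives.
      linarith
  have h := congrArg ((S.str i).φ x) key
  rw [map_neg, (S.str i).φ_sq, hη, zero_smul, add_zero, neg_neg] at h
  exact h

end Almost3ContactMetricStructure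

end Normality

/-! ### From ker η_i to arbitrary vector fields. -/

section Hypernormality

variable {d : ℕ} {M : Type*} [TopologicalSpace M]
  [ChartedSpace (EuclideanSpace ℝ (Fin d)) M] [IsManifold (𝓡 d) ∞ M]

/-- The derivative of f enters only as a multiple of ξ, which φ kills; this replaces tensoriality of
N. -/
theorem AlmostContactStructure.φ_mlieBracket_add_smul_ξ (S : AlmostContactStructure d M)
    {A X : VField d M} {f : M → ℝ} (hA : A.IsSmooth) (hf : ContMDiff (𝓡 d) 𝓘(ℝ) ∞ f)
    (hX : X = A + f • S.ξ) (P : VField d M) (x : M) :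
    S.φ x (mlieBracket (𝓡 d) P X x)
      = S.φ x (mlieBracket (𝓡 d) P A x) + f x • S.φ x (mlieBracket (𝓡 d) P S.ξ x) := by
  rw [hX, mlieBracket_add_of_isSmooth hA (VField.IsSmooth.smul hf S.smooth_ξ),
    mlieBracket_smul_of_isSmooth hf S.smooth_ξ]
  simp [S.φ_ξ]

theorem Almost3ContactMetricStructure.IsAlphaDeltaSasaki.isNormal
    {S : Almost3ContactMetricStructure d M} {α δ : ℝ} (hS : S.IsAlphaDeltaSasaki α δ)
    (i : Fin 3) : (S.str i).IsNormal := by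
  have split : ∀ X : VField d M, X.IsSmooth → ∃ (A : VField d M) (f : M → ℝ), A.IsSmooth ∧
      ContMDiff (𝓡 d) 𝓘(ℝ) ∞ f ∧ (∀ x, (S.str i).η x (A x) = 0) ∧ X = A + f • (S.str i).ξ ∧
      (S.str i).φ.app X = (S.str i).φ.app A := by
    intro X hX
    have hf := (S.str i).smooth_η.apply hX
    refine ⟨X - (fun x ↦ (S.str i).η x (X x)) • (S.str i).ξ, _,
      hX.sub (VField.IsSmooth.smul hf (S.str i).smooth_ξ), hf, fun x ↦ ?_,
      (sub_add_cancel _ _).symm, funext fun x ↦ ?_⟩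
    · simp [(S.str i).η_ξ]
    · simp [EndField.app, (S.str i).φ_ξ]
  intro X Y hX hY x
  obtain ⟨A, f, hA, hf, hA0, hXA, hφX⟩ := split X hX
  obtain ⟨A', h, hA', hh, hA0', hYA, hφY⟩ := split Y hY
  have hξ := hS.mlieBracket_ξ_φ i hA hA0 x
  have hξ' := hS.mlieBracket_ξ_φ i hA' hA0' x
  have hφ := hS.φ_mlieBracket i hA hA' hA0 hA0' x
  have hη := hS.η_mlieBracket i hA hA' x
  simp only [hA0, hA0', VField.deriv_const, sub_zero, zero_sub] at hη
  have hω : S.sasakiForm i x (X x) (Y x) α δ = S.sasakiForm i x (A x) (A' x) α δ := by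
    have e : ∀ v w : TangentSpace (𝓡 d) x, ∀ c : ℝ,
        S.sasakiForm i x (v + c • (S.str i).ξ x) w α δ = S.sasakiForm i x v w α δ := by
      intro v w c
      rw [S.sasakiForm_add_left, S.sasakiForm_smul_left, S.sasakiForm_ξ, mul_zero, add_zero]
    rw [hXA, hYA]
    simp only [Pi.add_apply, Pi.smul_apply']
    rw [e, S.sasakiForm_swap, e, S.sasakiForm_swap, neg_neg]
  -- The η_i-component of φ_i²[A, A'] is -dη_i(A, A') ξ_i, which cancels the last term of N.
  have hsq := (S.str i).φ_sq x (mlieBracket (𝓡 d) A A' x)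
  have splitX := fun P ↦ (S.str i).φ_mlieBracket_add_smul_ξ hA hf hXA P x
  have splitY := fun P ↦ (S.str i).φ_mlieBracket_add_smul_ξ hA' hh hYA P x
  rw [AlmostContactStructure.nijenhuis, hS.extD_eq i hX hY, hω, hφX, hφY, splitY, splitY,
    mlieBracket_swap_apply (V := X) (W := A'), mlieBracket_swap_apply (V := X) (W := (S.str i).ξ),
    mlieBracket_swap_apply (V := X) (W := (S.str i).φ.app A'), map_neg, map_neg, map_neg,
    splitX, splitX, splitX, mlieBracket_self,
    mlieBracket_swap_apply (V := A') (W := A),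
    mlieBracket_swap_apply (V := A') (W := (S.str i).ξ),
    mlieBracket_swap_apply (V := (S.str i).φ.app A') (W := A),
    mlieBracket_swap_apply (V := (S.str i).φ.app A') (W := (S.str i).ξ),
    mlieBracket_swap_apply (V := (S.str i).φ.app A) (W := (S.str i).ξ), hξ, hξ']
  rw [hη] at hsq
  rw [map_add] at hφ
  simp only [Pi.zero_apply, map_add, map_neg, map_smul, map_zero, smul_zero, smul_neg, hsq]
  have hφ' := eq_sub_of_add_eq hφ
  rw [hφ', neg_smul]
  module

end Hypernormality

theorem mainTheorem2 (n : ℕ) (M : Type*) [TopologicalSpace M] [T2Space M]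
    [ChartedSpace (EuclideanSpace ℝ (Fin (4 * n + 3))) M] [IsManifold (𝓡 (4 * n + 3)) ∞ M]
    (S : Almost3ContactMetricStructure (4 * n + 3) M) (α δ : ℝ)
    (hS : S.IsAlphaDeltaSasaki α δ) :
    S.IsHypernormal :=
  fun i ↦ hS.isNormal i
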